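/- Let $N\ge 2$ be an integer and let $R$ be a commutative ring. Let $D_s$ be an oriented singular link diagram in the plane, i.e. an oriented link diagram in which one crossing has been replaced by an edge labeled $2$: two strands labeled $1$ merge into this edge, and it then splits into two strands labeled $1$. For each function $v$ from the set of (remaining) crossings to $\{0,1\}$ let $D_v$ be the $\mathfrak{sl}(N)$ MOY graph obtained from $D_s$ by replacing each positive crossing $c$ by an edge labeled $2$ if $v(c)=0$ and by its oriented smoothing if $v(c)=1$, and each negative crossing $c$ by its oriented smoothing if $v(c)=0$ and by an edge labeled $2$ if $v(c)=1$. Let $\mathscr F_N(D_v;R)=R\otimes_{\mathbf Z}\mathscr F_N(D_v;\mathbf Z)$ be the state space of $D_v$ given by the universal construction from Robert--Wagner's evaluation of closed $\mathfrak{sl}(N)$ foams, where symmetric polynomials in $X_1,\dots,X_N$ without constant term act by zero. Let $\mathrm{KRC}_N(D_s;R)=\bigoplus_v\mathscr F_N(D_v;R)$ be the cube-of-resolutions chain complex, whose differential is the signed sum of the maps induced by the foams $D_v\to D_w$ that zip or unzip an edge labeled $2$ at one crossing. For a basepoint $q$ of $D_s$ away from the crossings and from the edge labeled $2$, let $X_q$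 be the chain map of $\mathrm{KRC}_N(D_s;R)$ that adds a dot of weight $1$ on the facet adjacent to $q$, and let $\overline{\mathrm{KR}}_N(D_s,q;R)$ be the homology of the subcomplex $X_q^{N-1}\mathrm{KRC}_N(D_s;R)$. For a further basepoint $r$, the chain map $X_r$ commutes with $X_q$ and induces the basepoint operator $X_r$ on $\overline{\mathrm{KR}}_N(D_s,q;R)$. Let $q$ and $r$ lie next to the edge labeled $2$ of $D_s$ (the edge that replaces the crossing), on the two different strands labeled $1$ that enter it, or on the two different strands labeled $1$ that leave it. Then, on $\overline{\mathrm{KR}}_N(D_s,q;R)$, $$X_r^{N-1}=0 .$$ -/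

import Mathlib

open scoped TensorProduct

noncomputable section

/-! ## Foams in the cubical lattice

Foams are drawn in the cubical lattice of `ℝ³`: facets are unions of unit lattice squares, seams are
unions of lattice edges.  Every foam in `ℝ³` is isotopic to such a foam. -/

namespace SlN

/-- Lattice points of `ℝ³`. -/
abbrev Pt := Fin 3 → ℤ

/-- The unit vector in direction `i`. -/
def unitVec (i : Fin 3) : Pt := Pi.single i 1

/-- `(p, i)` is the unit edge from `p` to `p + unitVec i`, oriented that way. -/
abbrev Edge := Pt × Fin 3

/-- `(p, i)` is the unit square with least corner `p`, spanned by the directions `i + 1`, `i + 2`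
(indices modulo 3) and oriented so that its normal is `+ unitVec i`. -/
abbrev Plaq := Pt × Fin 3

def Plaq.edges (P : Plaq) : Finset Edge :=
  {(P.1, P.2 + 1), (P.1, P.2 + 2), (P.1 + unitVec (P.2 + 1), P.2 + 2),
    (P.1 + unitVec (P.2 + 2), P.2 + 1)}

def Plaq.vertices (P : Plaq) : Finset Pt :=
  {P.1, P.1 + unitVec (P.2 + 1), P.1 + unitVec (P.2 + 2),
    P.1 + unitVec (P.2 + 1) + unitVec (P.2 + 2)}

/-- The Euler characteristic of the union of a finite set of squares. -/
def eulerChar (S : Finset Plaq) : ℤ :=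
  (S.biUnion Plaq.vertices).card - (S.biUnion Plaq.edges).card + S.card

/-- The four squares containing the edge `e`, in counterclockwise order around the oriented
edge `e`. -/
def around (e : Edge) : Fin 4 → Plaq :=
  ![(e.1, e.2 + 2), (e.1, e.2 + 1), (e.1 - unitVec (e.2 + 1), e.2 + 2),
    (e.1 - unitVec (e.2 + 2), e.2 + 1)]

/-- The coefficient of `e` in the boundary of the `k`-th square around `e`. -/
def incidence : Fin 4 → ℤ := ![1, -1, -1, 1]

/-- The coefficient of the edge `e` in the boundary of the 2-chain `f`. -/
def boundary (f : Plaq → ℤ) (e : Edge) : ℤ := ∑ k, incidence k * f (around e k)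

/-- The six lattice directions at a point: `(i, true)` is `+ unitVec i` and `(i, false)` is
`- unitVec i`. -/
abbrev Dir := Fin 3 × Bool

/-- The least corner of the square at `p` spanned by directions `a`, `b` is obtained from `p` by
subtracting the unit vectors of the negative ones; its normal is the third coordinate axis. -/
def corner (p : Pt) (a b : Dir) : Plaq :=
  (p - ((if a.2 then 0 else unitVec a.1) + (if b.2 then 0 else unitVec b.1)), -(a.1 + b.1))

/-- The link at `p` of the union of the squares on which `f` does not vanish: a subgraph of the
octahedron. -/
def link (f : Plaq → ℤ) (p : Pt) : SimpleGraph Dir where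
  Adj a b := a.1 ≠ b.1 ∧ f (corner p a b) ≠ 0
  symm := ⟨fun a b h => ⟨h.1.symm, by
    have : corner p b a = corner p a b := by
      unfold corner; rw [add_comm, add_comm b.1]
    rw [this]; exact h.2⟩⟩
  loopless := ⟨fun _ h => h.1 rfl⟩

/-- The finitely supported chain `f` is a closed foam: an oriented facet labeled `a > 0` is a region
where `f` has absolute value `a`, the orientation of the facet being the sign of `f`.
The conditions say that the flow is conserved along every edge, that at most three squares meet along
an edge (so that the edge lies inside a facet, or on a seam along which facets labeled `a`, `b` merge
into a facet labeled `a + b`), and that the link of each point of the foam is a circle (a point of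
the interior of a facet), a theta graph (a point of a seam) or the complete graph `K₄`
(a singular vertex): it is connected, and any two of its trivalent vertices are joined by an arc
all of whose interior vertices are bivalent. -/
structure IsClosedFoam (f : Plaq →₀ ℤ) : Prop where
  conservation : ∀ e, boundary f e = 0
  valence : ∀ e, (Finset.univ.filter fun k => f (around e k) ≠ 0).card ≤ 3
  link_connected : ∀ p a b, ((link f p).neighborSet a).Nonempty →
    ((link f p).neighborSet b).Nonempty → (link f p).Reachable a b
  link_arcs : ∀ p a b, ((link f p).neighborSet a).ncard = 3 →
    ((link f p).neighborSet b).ncard = 3 →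
    ∃ w : (link f p).Walk a b, ∀ u ∈ w.support,
      u = a ∨ u = b ∨ ((link f p).neighborSet u).ncard = 2

/-- The 2-chain carried by the set of squares `S`, with the orientation of `f`. -/
def orientedChain (f : Plaq →₀ ℤ) (S : Finset Plaq) (P : Plaq) : ℤ :=
  if P ∈ S then (f P).sign else 0

open scoped Classical in
/-- The colorings of the closed foam `f` by the pigments `0, …, N - 1`, each given by its pigment
surfaces `c i`: the union of the facets whose color contains `i`.  A facet labeled `a` is colored by
a set of `a` pigments, and each `c i` is a closed surface oriented by `f`; that is to say, the color of
a facet is constant, and along a seam the color of the facet labeled `a + b` is the disjoint union of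
the colors of the other two. -/
def colorings (N : ℕ) (f : Plaq →₀ ℤ) : Finset (Fin N → Finset Plaq) :=
  (Fintype.piFinset fun _ => f.support.powerset).filter fun c =>
    (∀ P, (Finset.univ.filter fun i => P ∈ c i).card = (f P).natAbs) ∧
      ∀ i e, boundary (orientedChain f (c i)) e = 0

/-- The `(i, j)`-positive seams: the edges along which a facet with `i` but not `j`, a facet with `j`
but not `i`, and a facet with both meet in this counterclockwise cyclic order with respect to the
orientation of the seam, which is that of the boundary of the thin facets. -/
def positiveSeam (f : Plaq →₀ ℤ) (Fi Fj : Finset Plaq) : Set Edge :=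
  {e | ∃ k l m : Fin 4, around e k ∈ Fi \ Fj ∧ around e l ∈ Fj \ Fi ∧ around e m ∈ Fi ∩ Fj ∧
    ((0 < incidence k * f (around e k) ∧ l - k < m - k) ∨
      (incidence k * f (around e k) < 0 ∧ m - k < l - k))}

/-- The number of circles formed by the positive seams, `θ⁺ᵢⱼ`. -/
def theta (f : Plaq →₀ ℤ) (Fi Fj : Finset Plaq) : ℕ :=
  Nat.card (SimpleGraph.fromRel fun e e' : positiveSeam f Fi Fj =>
    (({e.1.1, e.1.1 + unitVec e.1.2} : Finset Pt) ∩
      {e'.1.1, e'.1.1 + unitVec e'.1.2}).Nonempty).ConnectedComponent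

/-- The ring `ℤ[X₀, …, X_{N-1}]`. -/
abbrev Poly (N : ℕ) := MvPolynomial (Fin N) ℤ

/-- The field `ℚ(X₀, …, X_{N-1})`, in which foams are evaluated. -/
abbrev RatFun (N : ℕ) := FractionRing (Poly N)

def var {N : ℕ} (i : Fin N) : RatFun N := algebraMap (Poly N) (RatFun N) (MvPolynomial.X i)

/-- The colored evaluation
`⟨F, c⟩ = (-1)^(∑ᵢ i χ(Fᵢ)/2 + ∑_{i<j} θ⁺ᵢⱼ) ∏ P / ∏_{i<j} (Xᵢ - Xⱼ)^(χ(Fᵢⱼ)/2)`, where `Fᵢⱼ` is the symmetric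
difference of `Fᵢ` and `Fⱼ`, and a dot of weight `k` on a facet contributes to the numerator the `k`-th
elementary symmetric polynomial in the variables of the pigments of the facet. -/
def coloredEval {N : ℕ} (f : Plaq →₀ ℤ) (dots : Multiset (Plaq × ℕ)) (c : Fin N → Finset Plaq) :
    RatFun N :=
  (-1) ^ ((∑ i : Fin N, ((i : ℤ) + 1) * (eulerChar (c i) / 2)) +
      ∑ i : Fin N, ∑ j ∈ Finset.Ioi i, (theta f (c i) (c j) : ℤ)) *
    (dots.map fun d =>
      ∑ A ∈ (Finset.univ.filter fun i => d.1 ∈ c i).powersetCard d.2, ∏ i ∈ A, var i).prod /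
    ∏ i : Fin N, ∏ j ∈ Finset.Ioi i,
      (var i - var j) ^ (eulerChar (symmDiff (c i) (c j)) / 2)

open scoped Classical in
/-- The Robert-Wagner evaluation of a closed dotted foam, extended by zero to the chains that are not
foams. -/
def eval (N : ℕ) (f : Plaq →₀ ℤ) (dots : Multiset (Plaq × ℕ)) : RatFun N :=
  if IsClosedFoam f then ∑ c ∈ colorings N f, coloredEval f dots c else 0

/-! ## State spaces -/

/-- `(x, y, 0)` is the edge of the planar lattice from `(x, y)` to `(x + 1, y)`, and `(x, y, 1)` is the
edge from `(x, y)` to `(x, y + 1)`. -/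
abbrev PEdge := ℤ × ℤ × Fin 2

/-- A planar web (MOY graph) drawn in the planar lattice: an edge labeled `a` is a region where the
chain has absolute value `a`, oriented by the sign of the chain. -/
abbrev Web := PEdge →₀ ℤ

/-- The vertical unit square `e × [t, t + 1]`. -/
def wall (e : PEdge) (t : ℤ) : Plaq := (![e.1, e.2.1, t], if e.2.2 = 0 then 1 else 0)

/-- The foam `Γ × [t, t + 1]`, so oriented that its boundary contains `Γ × {t + 1}` positively. -/
def cylinder (Γ : Web) (t : ℤ) : Plaq →₀ ℤ :=
  Γ.sum fun e a => Finsupp.single (wall e t) (if e.2.2 = 0 then a else -a)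

/-- The square `P` lies in the half-space `z ≤ t`. -/
def IsBelow (t : ℤ) (P : Plaq) : Prop := P.1 2 + (if P.2 = 2 then 0 else 1) ≤ t

/-- The square `P` lies in the half-space `t ≤ z`. -/
def IsAbove (t : ℤ) (P : Plaq) : Prop := t ≤ P.1 2

/-- A dotted foam below a web placed at height `t`: a chain in the half-space `z ≤ t`, always continued
by the collar (web) `× [t, t + 1]`, and dots (square, weight) on it or on its collar.
No condition is imposed where the chain meets the web or on its local shape: chains that do not form a
foam with the collar have closures that all evaluate to zero, so they vanish in the state space. -/
@[ext] structure LowerFoam (t : ℤ) where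
  chain : Plaq →₀ ℤ
  dots : Multiset (Plaq × ℕ)
  chain_below : ∀ P ∈ chain.support, IsBelow t P
  dots_below : ∀ d ∈ dots, IsBelow (t + 1) d.1

/-- A dotted foam above a web at height `t`: it continues the collar (web) `× [t, t + 1]` in the
half-space `t + 1 ≤ z`. -/
structure UpperFoam (t : ℤ) where
  chain : Plaq →₀ ℤ
  dots : Multiset (Plaq × ℕ)
  chain_above : ∀ P ∈ chain.support, IsAbove (t + 1) P
  dots_above : ∀ d ∈ dots, IsAbove t d.1

/-- The evaluation of the closed foam `F ∪ (Γ × [t, t + 1]) ∪ G`. -/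
def closureEval (N : ℕ) (Γ : Web) {t : ℤ} (F : LowerFoam t) (G : UpperFoam t) : RatFun N :=
  eval N (F.chain + cylinder Γ t + G.chain) (F.dots + G.dots)

/-- The ring of symmetric polynomials in `X₀, …, X_{N-1}`. -/
def Sym (N : ℕ) : Type := MvPolynomial.symmetricSubalgebra (Fin N) ℤ

instance (N : ℕ) : CommRing (Sym N) :=
  inferInstanceAs (CommRing (MvPolynomial.symmetricSubalgebra (Fin N) ℤ))

/-- The inclusion of the symmetric polynomials into all polynomials. -/
def Sym.toPoly (N : ℕ) : Sym N →+* Poly N :=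
  (MvPolynomial.symmetricSubalgebra (Fin N) ℤ).val.toRingHom

instance (N : ℕ) : Module (Sym N) (RatFun N) :=
  Module.compHom (RatFun N) ((algebraMap (Poly N) (RatFun N)).comp (Sym.toPoly N))

/-- The ideal of symmetric polynomials without constant term. -/
def augIdeal (N : ℕ) : Ideal (Sym N) :=
  RingHom.ker (MvPolynomial.constantCoeff.comp (Sym.toPoly N))

/-- Pairing of combinations of lower foams with an upper foam. -/
def pairing (N : ℕ) (Γ : Web) {t : ℤ} (G : UpperFoam t) : (LowerFoam t →₀ Sym N) →ₗ[Sym N] RatFun N :=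
  Finsupp.linearCombination (Sym N) fun F => closureEval N Γ F G

/-- The combinations of lower foams all of whose closures evaluate to zero. -/
def radical (N : ℕ) (Γ : Web) (t : ℤ) : Submodule (Sym N) (LowerFoam t →₀ Sym N) :=
  ⨅ G : UpperFoam t, LinearMap.ker (pairing N Γ G)

/-- The relations of the nonequivariant state space: those of the universal construction over the
symmetric polynomials, together with the vanishing of the symmetric polynomials without
constant term. -/
def relations (N : ℕ) (Γ : Web) (t : ℤ) : Submodule (Sym N) (LowerFoam t →₀ Sym N) :=
  radical N Γ t ⊔ augIdeal N • ⊤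

/-- The state space `ℱ_N(Γ; ℤ)` of the web `Γ`, placed at height `t`. -/
abbrev IntStateSpace (N : ℕ) (Γ : Web) (t : ℤ) := (LowerFoam t →₀ Sym N) ⧸ relations N Γ t

/-- The state space `ℱ_N(Γ; R)` of the web `Γ`, placed at height `t`. -/
def StateSpace (N : ℕ) (R : Type*) [CommRing R] (Γ : Web) (t : ℤ) :=
  R ⊗[ℤ] IntStateSpace N Γ t

instance (N : ℕ) (R : Type*) [CommRing R] (Γ : Web) (t : ℤ) : AddCommGroup (StateSpace N R Γ t) :=
  inferInstanceAs (AddCommGroup (R ⊗[ℤ] IntStateSpace N Γ t))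

instance (N : ℕ) (R : Type*) [CommRing R] (Γ : Web) (t : ℤ) : Module R (StateSpace N R Γ t) :=
  inferInstanceAs (Module R (R ⊗[ℤ] IntStateSpace N Γ t))

lemma relations_le_comap {N : ℕ} {Γ Γ' : Web} {t t' : ℤ} (φ : LowerFoam t → LowerFoam t')
    (ψ : UpperFoam t' → UpperFoam t)
    (h : ∀ F G, closureEval N Γ' (φ F) G = closureEval N Γ F (ψ G)) :
    relations N Γ t ≤
      (relations N Γ' t').comap (Finsupp.lmapDomain (Sym N) (Sym N) φ) := by
  refine sup_le ?_ ?_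
  · intro x hx
    refine Submodule.mem_sup_left ?_
    simp only [radical, Submodule.mem_iInf, LinearMap.mem_ker] at hx ⊢
    intro G
    rw [← hx (ψ G)]
    simp only [pairing, Finsupp.lmapDomain_apply, Finsupp.linearCombination_mapDomain]
    congr 2
    funext F
    exact h F G
  · rw [← Submodule.map_le_iff_le_comap, Submodule.map_smul'']
    exact le_sup_of_le_right (Submodule.smul_mono le_rfl le_top)

/-- Add a dot of weight `k` on the collar over the edge `e` of the web. -/
def LowerFoam.addDot {t : ℤ} (e : PEdge) (k : ℕ) (F : LowerFoam t) : LowerFoam t where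
  chain := F.chain
  dots := (wall e t, k) ::ₘ F.dots
  chain_below := F.chain_below
  dots_below := by
    intro d hd
    rcases Multiset.mem_cons.1 hd with rfl | hd
    · simp [IsBelow, wall]; split_ifs <;> simp
    · exact F.dots_below d hd

/-- The weight `k` basepoint operator of the edge `e` on `ℱ_N(Γ; ℤ)`. -/
def intDotMap (N : ℕ) (Γ : Web) (t : ℤ) (e : PEdge) (k : ℕ) :
    IntStateSpace N Γ t →ₗ[Sym N] IntStateSpace N Γ t :=
  Submodule.mapQ _ _ (Finsupp.lmapDomain (Sym N) (Sym N) (LowerFoam.addDot e k))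
    (relations_le_comap _
      (fun G => ⟨G.chain, (wall e t, k) ::ₘ G.dots, G.chain_above, by
        intro d hd
        rcases Multiset.mem_cons.1 hd with rfl | hd
        · simp [IsAbove, wall]
        · exact G.dots_above d hd⟩)
      (by intro F G; simp [closureEval, LowerFoam.addDot]))

/-- The weight `k` basepoint operator of the edge `e` on `ℱ_N(Γ; R)`. -/
def dotMap (N : ℕ) (R : Type*) [CommRing R] (Γ : Web) (t : ℤ) (e : PEdge) (k : ℕ) :
    StateSpace N R Γ t →ₗ[R] StateSpace N R Γ t :=
  ((intDotMap N Γ t e k).restrictScalars ℤ).baseChange R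

lemma cylinder_support {Γ : Web} {t : ℤ} {P : Plaq} (h : P ∈ (cylinder Γ t).support) :
    P.1 2 = t ∧ P.2 ≠ 2 := by
  classical
  obtain ⟨e, -, he⟩ := Finset.mem_biUnion.1 (Finsupp.support_sum h)
  have := Finset.mem_singleton.1 (Finsupp.support_single_subset he)
  subst this
  refine ⟨by simp [wall], ?_⟩
  simp only [wall]; split_ifs <;> decide

/-- The horizontal unit square with lower left corner `p`, at height `t`. -/
def floor (p : ℤ × ℤ) (t : ℤ) : Plaq := (![p.1, p.2, t], 2)

/-- Glue to a lower foam for a web `Γ` at height `t` the foam consisting of the collar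
`Γ × [t, t + 1]` and `a` times the horizontal square `p` at height `t' = t + 1`. -/
def LowerFoam.stack {t t' : ℤ} (ht : t' = t + 1) (Γ : Web) (p : ℤ × ℤ) (a : ℤ) (F : LowerFoam t) :
    LowerFoam t' where
  chain := F.chain + cylinder Γ t + Finsupp.single (floor p t') a
  dots := F.dots
  chain_below := by
    classical
    subst ht
    intro P hP
    rcases Finset.mem_union.1 (Finsupp.support_add hP) with h | h
    · rcases Finset.mem_union.1 (Finsupp.support_add h) with h | h
      · have := F.chain_below P h
        unfold IsBelow at *; omega
      · obtain ⟨h1, h2⟩ := cylinder_support h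
        simp [IsBelow, h1, h2]
    · have := Finset.mem_singleton.1 (Finsupp.support_single_subset h)
      subst this
      simp [IsBelow, floor]
  dots_below := by
    intro d hd
    have := F.dots_below d hd
    unfold IsBelow at *; omega

/-- The map `ℱ_N(Γ; ℤ) → ℱ_N(Γ'; ℤ)` induced by the foam from `Γ` to `Γ'` that consists of cylinders over
`Γ` and `Γ'` and `a` times the horizontal square `p` in between. -/
def intFoamMap (N : ℕ) {t t' : ℤ} (ht : t' = t + 1) (Γ Γ' : Web) (p : ℤ × ℤ) (a : ℤ) :
    IntStateSpace N Γ t →ₗ[Sym N] IntStateSpace N Γ' t' :=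
  Submodule.mapQ _ _ (Finsupp.lmapDomain (Sym N) (Sym N) (LowerFoam.stack ht Γ p a))
    (relations_le_comap _
      (fun G => ⟨Finsupp.single (floor p t') a + cylinder Γ' t' + G.chain, G.dots, by
        classical
        subst ht
        intro P hP
        rcases Finset.mem_union.1 (Finsupp.support_add hP) with h | h
        · rcases Finset.mem_union.1 (Finsupp.support_add h) with h | h
          · have := Finset.mem_singleton.1 (Finsupp.support_single_subset h)
            subst this
            simp [IsAbove, floor]
          · simp [IsAbove, (cylinder_support h).1]
        · have := G.chain_above P h
          unfold IsAbove at *; omega, by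
        intro d hd
        have := G.dots_above d hd
        unfold IsAbove at *; omega⟩)
      (by intro F G; simp only [closureEval, LowerFoam.stack, add_assoc]))

def foamMap (N : ℕ) (R : Type*) [CommRing R] {t t' : ℤ} (ht : t' = t + 1) (Γ Γ' : Web)
    (p : ℤ × ℤ) (a : ℤ) : StateSpace N R Γ t →ₗ[R] StateSpace N R Γ' t' :=
  ((intFoamMap N ht Γ Γ' p a).restrictScalars ℤ).baseChange R

/-! ## Diagrams -/

/-- The boundary edges of the planar unit square with lower left corner `p`. -/
def square (p : ℤ × ℤ) : Finset PEdge :=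
  {(p.1, p.2, 0), (p.1 + 1, p.2, 1), (p.1, p.2 + 1, 0), (p.1, p.2, 1)}

/-- The counterclockwise boundary of the planar unit square with lower left corner `p`. -/
def squareBoundary (p : ℤ × ℤ) : Web :=
  Finsupp.single (p.1, p.2, 0) 1 + Finsupp.single (p.1 + 1, p.2, 1) 1 -
    Finsupp.single (p.1, p.2 + 1, 0) 1 - Finsupp.single (p.1, p.2, 1) 1

/-- An oriented singular link diagram with `n` crossings and one edge labeled `2`, drawn in the planar
lattice so that at each crossing, and at the edge labeled `2`, the strands point upwards.
It is recorded by the oriented curves `strands` obtained from it by taking the oriented smoothing at all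
these places, and by the lower left corners of the unit squares, the sites, where they
take place: `site (some c)` for the crossing `c` and `site none` for the edge labeled `2`.
At each site the smoothing consists of two vertical strands at distance one, pointing upwards. -/
structure SingularDiagram (n : ℕ) where
  strands : Web
  label : ∀ e, |strands e| ≤ 1
  conservation : ∀ x y, strands (x - 1, y, 0) + strands (x, y - 1, 1) =
    strands (x, y, 0) + strands (x, y, 1)
  valence : ∀ x y, |strands (x - 1, y, 0)| + |strands (x, y - 1, 1)| +
    |strands (x, y, 0)| + |strands (x, y, 1)| ≤ 2
  site : Option (Fin n) → ℤ × ℤ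
  positive : Fin n → Bool
  upward : ∀ s, ∀ i ∈ Finset.Icc (0 : ℤ) 1, ∀ j ∈ Finset.Icc (-1 : ℤ) 1,
    strands ((site s).1 + i, (site s).2 + j, 1) = 1
  disjoint : ∀ s s', s ≠ s' →
    2 ≤ |(site s).1 - (site s').1| ∨ 2 ≤ |(site s).2 - (site s').2|

namespace SingularDiagram

variable {n : ℕ} (D : SingularDiagram n)

/-- The web `D_v`.  Subtracting the boundary of the square at a site replaces the two vertical
strands there by two strands that merge into an edge labeled `2` and split again.  This is done at the
edge labeled `2` of `D`, at the positive crossings with `v c = 0` and at the negative crossings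
with `v c = 1` (`true` stands for `1`). -/
def resolution (v : Fin n → Bool) : Web :=
  D.strands - squareBoundary (D.site none) -
    ∑ c, if v c ≠ D.positive c then squareBoundary (D.site (some c)) else 0

/-- The number of ones of a vertex of the cube; the web `D_v` is placed at this height. -/
def height (v : Fin n → Bool) : ℤ := (Finset.univ.filter fun c => v c = true).card

lemma height_update {w : Fin n → Bool} {c : Fin n} (h : w c = true) :
    height w = height (Function.update w c false) + 1 := by
  unfold height
  have : (Finset.univ.filter fun d => w d = true) =
      insert c (Finset.univ.filter fun d => Function.update w c false d = true) := by
    ext d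
    by_cases hd : d = c
    · subst hd; simp [h]
    · simp [hd]
  rw [this, Finset.card_insert_of_notMem (by simp)]
  push_cast; ring

/-- The underlying module of `KRC_N(D; R)`: the direct sum of the state spaces of the webs `D_v`. -/
def Complex (N : ℕ) (R : Type*) [CommRing R] :=
  ∀ v : Fin n → Bool, StateSpace N R (D.resolution v) (height v)

instance (N : ℕ) (R : Type*) [CommRing R] : AddCommGroup (D.Complex N R) :=
  inferInstanceAs (AddCommGroup (∀ v : Fin n → Bool, StateSpace N R (D.resolution v) (height v)))

instance (N : ℕ) (R : Type*) [CommRing R] : Module R (D.Complex N R) :=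
  inferInstanceAs (Module R (∀ v : Fin n → Bool, StateSpace N R (D.resolution v) (height v)))

/-- The component of a chain at the vertex `v` of the cube. -/
def component (N : ℕ) (R : Type*) [CommRing R] (v : Fin n → Bool) :
    D.Complex N R →ₗ[R] StateSpace N R (D.resolution v) (height v) :=
  LinearMap.proj v

/-- The map into the complex with given components. -/
def ofComponents {N : ℕ} {R : Type*} [CommRing R] {M : Type*} [AddCommGroup M] [Module R M]
    (φ : ∀ v, M →ₗ[R] StateSpace N R (D.resolution v) (height v)) : M →ₗ[R] D.Complex N R :=
  LinearMap.pi φ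

/-- The differential of `KRC_N(D; R)`.  The foam from `D_v` to `D_w`, where `w c = 1` and `v c = 0`, is the
cylinder over the web except for one horizontal square at the crossing `c`, which zips or unzips the
edge labeled `2`; its sign is `-1` to the number of `c' < c` with `w c' = 1`. -/
def differential (N : ℕ) (R : Type*) [CommRing R] : D.Complex N R →ₗ[R] D.Complex N R :=
  D.ofComponents fun w => ∑ c, if h : w c = true then
    ((-1 : R) ^ (Finset.univ.filter fun c' => c' < c ∧ w c' = true).card) •
      (foamMap N R (height_update h) (D.resolution (Function.update w c false)) (D.resolution w)
        (D.site (some c)) (if D.positive c then 1 else -1)).comp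
        (D.component N R (Function.update w c false))
    else 0

/-- A basepoint on `D` away from the crossings and from the edge labeled `2`. -/
structure Basepoint where
  edge : PEdge
  on_strand : D.strands edge ≠ 0
  away : ∀ s, edge ∉ square (D.site s)

variable {D}

/-- The basepoint operator `X_q` on `KRC_N(D; R)`. -/
def Basepoint.op (q : D.Basepoint) (N : ℕ) (R : Type*) [CommRing R] :
    D.Complex N R →ₗ[R] D.Complex N R :=
  D.ofComponents fun v =>
    (dotMap N R (D.resolution v) (height v) q.edge 1).comp (D.component N R v)

end SingularDiagram

/-! ### Basepoint operators commute with each other and with the differential -/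

lemma intDotMap_comm (N : ℕ) (Γ : Web) (t : ℤ) (e e' : PEdge) (k k' : ℕ) :
    (intDotMap N Γ t e k).comp (intDotMap N Γ t e' k') =
      (intDotMap N Γ t e' k').comp (intDotMap N Γ t e k) := by
  refine Submodule.linearMap_qext _ (Finsupp.lhom_ext' fun F => LinearMap.ext_ring ?_)
  simp only [intDotMap, LinearMap.comp_apply, Finsupp.lsingle_apply, Submodule.mkQ_apply,
    Submodule.mapQ_apply, Finsupp.lmapDomain_apply, Finsupp.mapDomain_single]
  have : LowerFoam.addDot e k (LowerFoam.addDot e' k' F) =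
      LowerFoam.addDot e' k' (LowerFoam.addDot e k F) :=
    LowerFoam.ext rfl (Multiset.cons_swap _ _ _)
  rw [this]

lemma dotMap_comm (N : ℕ) (R : Type*) [CommRing R] (Γ : Web) (t : ℤ) (e e' : PEdge) (k k' : ℕ)
    (x : StateSpace N R Γ t) :
    dotMap N R Γ t e k (dotMap N R Γ t e' k' x) = dotMap N R Γ t e' k' (dotMap N R Γ t e k x) := by
  have h : (dotMap N R Γ t e k).comp (dotMap N R Γ t e' k') =
      (dotMap N R Γ t e' k').comp (dotMap N R Γ t e k) := by
    unfold dotMap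
    erw [← LinearMap.baseChange_comp, ← LinearMap.baseChange_comp]
    congr 1
    exact congrArg (LinearMap.restrictScalars ℤ) (intDotMap_comm N Γ t e e' k k')
  exact LinearMap.congr_fun h x

lemma wall_injective (t : ℤ) : Function.Injective fun e => wall e t := by
  rintro ⟨x, y, d⟩ ⟨x', y', d'⟩ h
  simp only [wall, Prod.mk.injEq] at h
  obtain ⟨h1, h2⟩ := h
  have hx := congrFun h1 0
  have hy := congrFun h1 1
  simp at hx hy
  subst hx hy
  fin_cases d <;> fin_cases d' <;> simp_all

lemma cylinder_wall (Γ : Web) (t : ℤ) (e : PEdge) :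
    cylinder Γ t (wall e t) = if e.2.2 = 0 then Γ e else -Γ e := by
  classical
  unfold cylinder
  rw [Finsupp.sum_apply, Finsupp.sum_eq_single e]
  · simp
  · intro e' _ hne
    exact Finsupp.single_eq_of_ne fun h => hne (wall_injective t h).symm
  · simp

/-- A dot may move along the wall over an edge, past a height at which no horizontal square is
adjacent to that edge. -/
lemma mem_wall_iff {N : ℕ} {f : Plaq →₀ ℤ} {c : Fin N → Finset Plaq} (hc : c ∈ colorings N f)
    (e : PEdge) (t : ℤ) (hw : f (wall e t) = f (wall e (t + 1)))
    (hf : ∀ p, e ∈ square p → f (floor p (t + 1)) = 0) (i : Fin N) :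
    wall e t ∈ c i ↔ wall e (t + 1) ∈ c i := by
  classical
  unfold colorings at hc
  rw [Finset.mem_filter, Fintype.mem_piFinset] at hc
  obtain ⟨hsub, -, hbd⟩ := hc
  have key : orientedChain f (c i) (wall e t) = orientedChain f (c i) (wall e (t + 1)) := by
    obtain ⟨x, y, d⟩ := e
    have h0 : ∀ p, (x, y, d) ∈ square p → orientedChain f (c i) (floor p (t + 1)) = 0 := by
      intro p hp
      simp [orientedChain, hf p hp]
    fin_cases d
    · have hb := hbd i (![x, y, t + 1], 0)
      have h1 := h0 (x, y) (by simp [square])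
      have h2 := h0 (x, y - 1) (by simp [square])
      have e2 : (![x, y, t + 1] - unitVec 1 : Pt) = ![x, y - 1, t + 1] := by
        ext j; fin_cases j <;> simp [unitVec]
      have e3 : (![x, y, t + 1] - unitVec 2 : Pt) = ![x, y, t] := by
        ext j; fin_cases j <;> simp [unitVec]
      simp [boundary, Fin.sum_univ_four, incidence, around, e2, e3] at hb
      simp [floor] at h1 h2
      simp [wall]
      rw [h1, h2] at hb
      linarith
    · have hb := hbd i (![x, y, t + 1], 1)
      have h1 := h0 (x, y) (by simp [square])
      have h2 := h0 (x - 1, y) (by simp [square])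
      have e2 : (![x, y, t + 1] - unitVec 0 : Pt) = ![x - 1, y, t + 1] := by
        ext j; fin_cases j <;> simp [unitVec]
      have e3 : (![x, y, t + 1] - unitVec 2 : Pt) = ![x, y, t] := by
        ext j; fin_cases j <;> simp [unitVec]
      have a1 : (1 + 2 : Fin 3) = 0 := rfl
      have a2 : (1 + 1 : Fin 3) = 2 := rfl
      simp only [boundary, Fin.sum_univ_four, incidence, around, a1, a2] at hb
      simp [e2, e3] at hb
      simp [floor] at h1 h2
      simp [wall]
      rw [h1, h2] at hb
      linarith
  by_cases h : f (wall e t) = 0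
  · have h' : f (wall e (t + 1)) = 0 := hw ▸ h
    constructor <;> intro hm
    · exact absurd h (Finsupp.mem_support_iff.1 (Finset.mem_powerset.1 (hsub i) hm))
    · exact absurd h' (Finsupp.mem_support_iff.1 (Finset.mem_powerset.1 (hsub i) hm))
  · have hs : (f (wall e (t + 1))).sign ≠ 0 := by
      rw [← hw]; exact fun h' => h (Int.sign_eq_zero_iff_zero.1 h')
    unfold orientedChain at key
    rw [hw] at key
    by_cases h1 : wall e t ∈ c i <;> by_cases h2 : wall e (t + 1) ∈ c i <;> simp_all

lemma intFoamMap_comp_intDotMap (N : ℕ) {t t' : ℤ} (ht : t' = t + 1) (Γ Γ' : Web) (p : ℤ × ℤ) (a : ℤ)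
    (e : PEdge) (k : ℕ) (he : e ∉ square p) (hΓ : Γ e = Γ' e) :
    (intFoamMap N ht Γ Γ' p a).comp (intDotMap N Γ t e k) =
      (intDotMap N Γ' t' e k).comp (intFoamMap N ht Γ Γ' p a) := by
  classical
  refine Submodule.linearMap_qext _ (Finsupp.lhom_ext' fun F => LinearMap.ext_ring ?_)
  simp only [intDotMap, intFoamMap, LinearMap.comp_apply, Finsupp.lsingle_apply,
    Submodule.mkQ_apply, Submodule.mapQ_apply, Finsupp.lmapDomain_apply,
    Finsupp.mapDomain_single]
  rw [Submodule.Quotient.eq]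
  refine Submodule.mem_sup_left ?_
  simp only [radical, Submodule.mem_iInf, LinearMap.mem_ker]
  intro G
  rw [map_sub, sub_eq_zero]
  simp only [pairing, Finsupp.linearCombination_single, one_smul]
  subst ht
  simp only [closureEval, LowerFoam.stack, LowerFoam.addDot, Multiset.cons_add, eval]
  split_ifs with hfoam
  swap
  · rfl
  refine Finset.sum_congr rfl fun c hc => ?_
  have hF : ∀ P, ¬ IsBelow t P → F.chain P = 0 := fun P hP => by
    by_contra h; exact hP (F.chain_below P (Finsupp.mem_support_iff.2 h))
  have hG : ∀ P, ¬ IsAbove (t + 1 + 1) P → G.chain P = 0 := fun P hP => by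
    by_contra h; exact hP (G.chain_above P (Finsupp.mem_support_iff.2 h))
  have hC : ∀ (Δ : Web) (s : ℤ) (P : Plaq), ¬ (P.1 2 = s ∧ P.2 ≠ 2) → cylinder Δ s P = 0 :=
    fun Δ s P hP => by
      by_contra h; exact hP (cylinder_support (Finsupp.mem_support_iff.2 h))
  have hwall : ∀ s, (wall e s).2 ≠ 2 := by
    intro s; simp only [wall]; split_ifs <;> decide
  have hwall2 : ∀ s, (wall e s).1 2 = s := by intro s; simp [wall]
  have hS : ∀ s, Finsupp.single (floor p (t + 1)) a (wall e s) = 0 := by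
    intro s
    refine Finsupp.single_eq_of_ne fun h => hwall s ?_
    rw [h]; rfl
  have hmem := mem_wall_iff hc e t
    (by
      simp only [Finsupp.add_apply, hS]
      rw [hF (wall e t) (by simp [IsBelow, hwall, hwall2]),
        hF (wall e (t + 1)) (by simp [IsBelow, hwall, hwall2]),
        hG (wall e t) (by simp [IsAbove, hwall2]),
        hG (wall e (t + 1)) (by simp [IsAbove, hwall2]),
        hC Γ t (wall e (t + 1)) (by simp [hwall2]),
        hC Γ' (t + 1) (wall e t) (by simp [hwall2]),
        cylinder_wall, cylinder_wall, hΓ]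
      simp)
    (by
      intro p' hp'
      have hne : p' ≠ p := by rintro rfl; exact he hp'
      simp only [Finsupp.add_apply]
      rw [hF _ (by simp [IsBelow, floor]), hG _ (by simp [IsAbove, floor]),
        hC _ _ _ (by simp [floor]), hC _ _ _ (by simp [floor]), Finsupp.single_eq_of_ne]
      · simp
      · intro h
        apply hne
        have h0 := congrFun (congrArg Prod.fst h) 0
        have h1 := congrFun (congrArg Prod.fst h) 1
        simp [floor] at h0 h1
        exact Prod.ext h0 h1)
  simp only [coloredEval, Multiset.map_cons, hmem]

lemma foamMap_dotMap (N : ℕ) (R : Type*) [CommRing R] {t t' : ℤ} (ht : t' = t + 1) (Γ Γ' : Web)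
    (p : ℤ × ℤ) (a : ℤ) (e : PEdge) (k : ℕ) (he : e ∉ square p) (hΓ : Γ e = Γ' e)
    (x : StateSpace N R Γ t) :
    foamMap N R ht Γ Γ' p a (dotMap N R Γ t e k x) =
      dotMap N R Γ' t' e k (foamMap N R ht Γ Γ' p a x) := by
  have h : (foamMap N R ht Γ Γ' p a).comp (dotMap N R Γ t e k) =
      (dotMap N R Γ' t' e k).comp (foamMap N R ht Γ Γ' p a) := by
    unfold dotMap foamMap
    erw [← LinearMap.baseChange_comp, ← LinearMap.baseChange_comp]
    congr 1
    exact congrArg (LinearMap.restrictScalars ℤ)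
      (intFoamMap_comp_intDotMap N ht Γ Γ' p a e k he hΓ)
  exact LinearMap.congr_fun h x

namespace SingularDiagram

variable {n : ℕ} {D : SingularDiagram n}

lemma Basepoint.resolution_edge (q : D.Basepoint) (v : Fin n → Bool) :
    D.resolution v q.edge = D.strands q.edge := by
  have h : ∀ s, squareBoundary (D.site s) q.edge = 0 := by
    intro s
    have hq := q.away s
    simp only [square, Finset.mem_insert, Finset.mem_singleton, not_or] at hq
    obtain ⟨h1, h2, h3, h4⟩ := hq
    simp [squareBoundary, Finsupp.single_eq_of_ne h1, Finsupp.single_eq_of_ne h2,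
      Finsupp.single_eq_of_ne h3, Finsupp.single_eq_of_ne h4]
  simp only [resolution, Finsupp.sub_apply, h, Finsupp.finsetSum_apply]
  rw [Finset.sum_eq_zero]
  · simp
  · intro c _
    split_ifs
    · exact h _
    · rfl

lemma Basepoint.op_comm (q r : D.Basepoint) (N : ℕ) (R : Type*) [CommRing R] :
    Commute (q.op N R) (r.op N R) := by
  refine LinearMap.ext fun x => funext fun v => ?_
  exact dotMap_comm N R (D.resolution v) (height v) q.edge r.edge 1 1 (x v)

lemma Basepoint.op_differential (q : D.Basepoint) (N : ℕ) (R : Type*) [CommRing R] :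
    Commute (q.op N R) (D.differential N R) := by
  refine LinearMap.ext fun x => funext fun w => ?_
  change dotMap N R _ _ q.edge 1 ((∑ c, _ : D.Complex N R →ₗ[R] _) x) =
    (∑ c, _ : D.Complex N R →ₗ[R] _) (q.op N R x)
  rw [LinearMap.sum_apply, LinearMap.sum_apply, map_sum]
  refine Finset.sum_congr rfl fun c _ => ?_
  split_ifs with h h'
  · rw [LinearMap.smul_apply, LinearMap.smul_apply, map_smul]
    congr 1
    exact (foamMap_dotMap N R _ _ _ _ _ _ _ (q.away _)
      (by rw [q.resolution_edge, q.resolution_edge]) _).symm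
  · rw [LinearMap.smul_apply, LinearMap.smul_apply, map_smul]
    congr 1
    exact (foamMap_dotMap N R _ _ _ _ _ _ _ (q.away _)
      (by rw [q.resolution_edge, q.resolution_edge]) _).symm
  · rw [LinearMap.zero_apply, LinearMap.zero_apply, map_zero]

/-! ## Reduced homology -/

variable (D) in
/-- The chains of the reduced complex, `X_q^(N-1) KRC_N(D; R)`. -/
def reducedChains (N : ℕ) (R : Type*) [CommRing R] (q : D.Basepoint) :
    Submodule R (D.Complex N R) :=
  LinearMap.range (q.op N R ^ (N - 1))

variable (D) in
/-- The cycles of the reduced complex. -/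
def reducedCycles (N : ℕ) (R : Type*) [CommRing R] (q : D.Basepoint) :
    Submodule R (D.Complex N R) :=
  D.reducedChains N R q ⊓ LinearMap.ker (D.differential N R)

variable (D) in
/-- The boundaries of the reduced complex. -/
def reducedBoundaries (N : ℕ) (R : Type*) [CommRing R] (q : D.Basepoint) :
    Submodule R (D.Complex N R) :=
  (D.reducedChains N R q).map (D.differential N R)

variable (D) in
/-- The reduced `sl(N)` homology of `D` with respect to `q`: the homology, over all homological degrees,
of `X_q^(N-1) KRC_N(D; R)`, that is, cycles modulo those cycles that are boundaries. -/
abbrev ReducedHomology (N : ℕ) (R : Type*) [CommRing R] (q : D.Basepoint) :=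
  D.reducedCycles N R q ⧸ (D.reducedBoundaries N R q).submoduleOf (D.reducedCycles N R q)

lemma op_mem_reducedChains {N : ℕ} {R : Type*} [CommRing R] {q : D.Basepoint} (r : D.Basepoint)
    {x : D.Complex N R} (hx : x ∈ D.reducedChains N R q) : r.op N R x ∈ D.reducedChains N R q := by
  obtain ⟨y, rfl⟩ := hx
  exact ⟨r.op N R y, LinearMap.congr_fun ((q.op_comm r N R).pow_left (N - 1)) y⟩

lemma op_mem_reducedCycles {N : ℕ} {R : Type*} [CommRing R] {q : D.Basepoint} (r : D.Basepoint)
    {x : D.Complex N R} (hx : x ∈ D.reducedCycles N R q) : r.op N R x ∈ D.reducedCycles N R q := by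
  refine ⟨op_mem_reducedChains r hx.1, ?_⟩
  have h := LinearMap.congr_fun (r.op_differential N R) x
  have hx2 : D.differential N R x = 0 := hx.2
  simp only [Module.End.mul_apply, hx2, map_zero] at h
  exact h.symm

lemma op_mem_reducedBoundaries {N : ℕ} {R : Type*} [CommRing R] {q : D.Basepoint}
    (r : D.Basepoint) {x : D.Complex N R} (hx : x ∈ D.reducedBoundaries N R q) :
    r.op N R x ∈ D.reducedBoundaries N R q := by
  obtain ⟨y, hy, rfl⟩ := hx
  exact ⟨r.op N R y, op_mem_reducedChains r hy,
    (LinearMap.congr_fun (r.op_differential N R) y).symm⟩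

/-- The basepoint operator `X_r` on the reduced homology with respect to `q`. -/
def reducedOp (N : ℕ) (R : Type*) [CommRing R] (q r : D.Basepoint) :
    Module.End R (D.ReducedHomology N R q) :=
  Submodule.mapQ _ _ ((r.op N R).restrict fun _ hx => op_mem_reducedCycles r hx)
    fun _ hx => op_mem_reducedBoundaries r hx

variable (D) in
/-- The four basepoints adjacent to the edge labeled `2`: on the strands that enter it from below
(`top = false`) or leave it at the top (`top = true`), on the left or on the right. -/
def leg (top right : Bool) : D.Basepoint where
  edge := ((D.site none).1 + (if right then 1 else 0), (D.site none).2 + (if top then 1 else -1), 1)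
  on_strand := by
    rw [D.upward none _ (by cases right <;> simp) _ (by cases top <;> simp)]
    exact one_ne_zero
  away := by
    intro s hs
    by_cases h : s = none
    · subst h
      cases top <;> cases right <;> simp [square] at hs
    · have := D.disjoint s none h
      simp only [square, Finset.mem_insert, Finset.mem_singleton, Prod.mk.injEq] at hs
      rw [le_abs, le_abs] at this
      cases top <;> cases right <;> simp at hs <;> omega

end SingularDiagram

end SlN

end

namespace SlN

/-! The vanishing already holds on each state space, before homology is taken: the product of the
two operators' `(N - 1)`-st powers is zero. So `X_r ^ (N - 1)` kills every chain of `X_q ^ (N - 1)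
KRC_N`, and hence every reduced homology class.

In a coloring of a closed foam, a facet labeled `1` carries one pigment `i`, and a dot on it
multiplies the colored evaluation by `Xᵢ`. The two legs on one side of the edge labeled `2` carry
different pigments `i ≠ j`: by conservation of each pigment's flow, a common pigment would pass
twice through that edge (`distinctPigments_leg`). Therefore any polynomial identity with symmetric
coefficients valid for all `Xᵢ`, `Xⱼ` with `i ≠ j` becomes an identity between the dot operators
`X`, `Y` of the legs (`sum_smul_intDotMap_eq_zero`).

Two identities are used, with `p(T) = ∏ (T - Xₖ)`: the root equation `p(Xᵢ) = 0`, and the vanishing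
of the divided difference `(p(Xᵢ) - p(Xⱼ)) / (Xᵢ - Xⱼ)`. The lower coefficients of `p` are, up to
sign, elementary symmetric polynomials of positive degree, which act by zero. What remains is `X ^ N
= 0` and `∑ X ^ l Y ^ (N - 1 - l) = 0`. Multiplying the latter by `X ^ (N - 1)` leaves only `X ^ (N
- 1) Y ^ (N - 1) = 0`. -/

/-! ### The characteristic polynomial of the variables -/

/-- The elementary symmetric polynomial of degree `k`. -/
noncomputable def symEsymm (N k : ℕ) : Sym N :=
  ⟨MvPolynomial.esymm (Fin N) ℤ k, MvPolynomial.esymm_isSymmetric (Fin N) ℤ k⟩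

lemma symEsymm_zero (N : ℕ) : symEsymm N 0 = 1 :=
  Subtype.ext (MvPolynomial.esymm_zero (Fin N) ℤ)

lemma symEsymm_mem_augIdeal (N : ℕ) {k : ℕ} (hk : k ≠ 0) : symEsymm N k ∈ augIdeal N := by
  change MvPolynomial.constantCoeff (MvPolynomial.esymm (Fin N) ℤ k) = 0
  rw [MvPolynomial.esymm, map_sum]
  refine Finset.sum_eq_zero fun A hA => ?_
  obtain ⟨i, hi⟩ : A.Nonempty := by
    rw [← Finset.card_pos, (Finset.mem_powersetCard.1 hA).2]; omega
  rw [map_prod]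
  exact Finset.prod_eq_zero hi (MvPolynomial.constantCoeff_X ℤ i)

lemma smul_ratFun {N : ℕ} (s : Sym N) (x : RatFun N) :
    s • x = algebraMap (Poly N) (RatFun N) (Sym.toPoly N s) * x := rfl

/-- Every variable is a root of the polynomial with roots `X₀, …, X_{N-1}`. -/
lemma sum_symEsymm_smul_var_pow {N : ℕ} (i : Fin N) :
    ∑ k ∈ Finset.range (N + 1), ((-1) ^ k * symEsymm N k) • (var i ^ (N - k) : RatFun N) = 0 := by
  -- Vieta's expansion of `∏ (T - Xₖ)`, evaluated at `T = Xᵢ`, where the factor with `k = i`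
  -- vanishes.
  have h := congrArg (Polynomial.eval (MvPolynomial.X i))
    (Multiset.prod_X_sub_X_eq_sum_esymm
      ((Finset.univ : Finset (Fin N)).val.map (MvPolynomial.X : Fin N → Poly N)))
  rw [Multiset.map_map, Finset.prod_map_val, Polynomial.eval_prod,
    Finset.prod_eq_zero (Finset.mem_univ i) (by simp)] at h
  have h2 := congrArg (algebraMap (Poly N) (RatFun N)) h
  rw [map_zero, Polynomial.eval_finsetSum, map_sum] at h2
  rw [h2]
  simp only [Multiset.card_map, Finset.card_val, Finset.card_univ, Fintype.card_fin]
  refine Finset.sum_congr rfl fun k _ => ?_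
  rw [smul_ratFun, var, ← map_pow, ← map_mul, map_mul (Sym.toPoly N), map_pow (Sym.toPoly N),
    map_neg, map_one, ← MvPolynomial.esymm_eq_multiset_esymm]
  congr 1
  simp only [Polynomial.eval_mul, Polynomial.eval_pow, Polynomial.eval_neg, Polynomial.eval_one,
    Polynomial.eval_C, Polynomial.eval_X, mul_assoc]
  rfl

/-- The sum is the divided difference of the characteristic polynomial at two of its roots:
multiplied by `Xᵢ - Xⱼ ≠ 0` it becomes the difference of two zeros. For `k = N` the inner sum is
empty, matching the constant term, which cancels in the difference. -/
lemma sum_symEsymm_smul_geom_sum {N : ℕ} {i j : Fin N} (hij : i ≠ j) :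
    ∑ k ∈ Finset.range (N + 1), ((-1) ^ k * symEsymm N k) •
      ∑ l ∈ Finset.range (N - k), (var i ^ l * var j ^ (N - k - 1 - l) : RatFun N) = 0 := by
  have hne : (var i - var j : RatFun N) ≠ 0 := by
    rw [sub_ne_zero]
    exact fun h => hij (MvPolynomial.X_injective (IsFractionRing.injective _ _ h))
  refine (mul_eq_zero.1 ?_).resolve_right hne
  have h := congrArg₂ (· - ·) (sum_symEsymm_smul_var_pow i) (sum_symEsymm_smul_var_pow j)
  simp only [← Finset.sum_sub_distrib, ← smul_sub, sub_zero] at h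
  rw [← h, Finset.sum_mul]
  refine Finset.sum_congr rfl fun k _ => ?_
  rw [smul_ratFun, mul_assoc, geom_sum₂_mul, smul_ratFun]

/-! ### Dots on edges labeled `1` -/

/-- Add `a` dots of weight `1` on the collar over `e` and `b` of them on the collar over `e'`. -/
noncomputable def LowerFoam.addDots {t : ℤ} (e e' : PEdge) (a b : ℕ) (F : LowerFoam t) :
    LowerFoam t :=
  (LowerFoam.addDot e 1)^[a] ((LowerFoam.addDot e' 1)^[b] F)

lemma LowerFoam.iterate_addDot_chain {t : ℤ} (e : PEdge) (a : ℕ) (F : LowerFoam t) :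
    ((LowerFoam.addDot e 1)^[a] F).chain = F.chain := by
  induction a with
  | zero => rfl
  | succ a ih => rw [Function.iterate_succ_apply']; exact ih

lemma LowerFoam.iterate_addDot_dots {t : ℤ} (e : PEdge) (a : ℕ) (F : LowerFoam t) :
    ((LowerFoam.addDot e 1)^[a] F).dots = Multiset.replicate a (wall e t, 1) + F.dots := by
  induction a with
  | zero => simp
  | succ a ih =>
    rw [Function.iterate_succ_apply', Multiset.replicate_succ, Multiset.cons_add, ← ih]; rfl

/-- On a facet with the single pigment `i`, a dot of weight `1` contributes the first elementary
symmetric polynomial of one variable, which is that variable. -/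
lemma coloredEval_replicate_add {N : ℕ} {f : Plaq →₀ ℤ} {c : Fin N → Finset Plaq} {P : Plaq}
    {i : Fin N} (h : ∀ k, P ∈ c k ↔ k = i) (a : ℕ) (dots : Multiset (Plaq × ℕ)) :
    coloredEval f (Multiset.replicate a (P, 1) + dots) c = var i ^ a * coloredEval f dots c := by
  classical
  have h1 : (Finset.univ.filter fun k => P ∈ c k) = {i} := by ext k; simp [h]
  simp only [coloredEval, Multiset.map_add, Multiset.prod_add, Multiset.map_replicate,
    Multiset.prod_replicate, h1]
  rw [show ∑ A ∈ ({i} : Finset (Fin N)).powersetCard 1, ∏ k ∈ A, var k = var i by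
    simp [Finset.powersetCard_one]]
  ring

/-! ### Pigments on the collar of a web. -/

/-- The chain of a closed foam restricts to the collar of the web as the cylinder. -/
lemma closure_wall {Γ : Web} {t : ℤ} (F : LowerFoam t) (G : UpperFoam t) (e : PEdge) :
    (F.chain + cylinder Γ t + G.chain) (wall e t) = if e.2.2 = 0 then Γ e else -Γ e := by
  have hF : F.chain (wall e t) = 0 := by
    by_contra h
    have := F.chain_below _ (Finsupp.mem_support_iff.2 h)
    simp only [IsBelow, wall] at this
    split_ifs at this <;> simp_all
  have hG : G.chain (wall e t) = 0 := by
    by_contra h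
    have := G.chain_above _ (Finsupp.mem_support_iff.2 h)
    simp [IsAbove, wall] at this
  simp only [Finsupp.add_apply, hF, hG, cylinder_wall, zero_add, add_zero]

/-- A coloring of a closed foam assigns a unique pigment to the collar over an edge labeled `1`. -/
lemma exists_pigment {N : ℕ} {Γ : Web} {t : ℤ} {F : LowerFoam t} {G : UpperFoam t}
    {c : Fin N → Finset Plaq} (hc : c ∈ colorings N (F.chain + cylinder Γ t + G.chain))
    {e : PEdge} (he : (Γ e).natAbs = 1) : ∃ i, ∀ k, wall e t ∈ c k ↔ k = i := by
  classical
  unfold colorings at hc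
  have h := (Finset.mem_filter.1 hc).2.1 (wall e t)
  rw [closure_wall] at h
  have h1 : (if e.2.2 = 0 then Γ e else -Γ e).natAbs = 1 := by split_ifs <;> simp [he]
  rw [h1, Finset.card_eq_one] at h
  obtain ⟨i, hi⟩ := h
  refine ⟨i, fun k => ?_⟩
  have := Finset.ext_iff.1 hi k
  simpa using this

open scoped Classical in
/-- The web carried by a pigment. -/
noncomputable def pigmentWeb {N : ℕ} (Γ : Web) (t : ℤ) (c : Fin N → Finset Plaq) (i : Fin N)
    (e : PEdge) : ℤ :=
  if wall e t ∈ c i then (Γ e).sign else 0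

/-- The vertical lattice edge over the point `(x, y)` of the collar meets exactly the walls over the
four planar edges at that point, and the pigment surface has no boundary there. -/
lemma pigmentWeb_conservation {N : ℕ} {Γ : Web} {t : ℤ} {F : LowerFoam t} {G : UpperFoam t}
    {c : Fin N → Finset Plaq} (hc : c ∈ colorings N (F.chain + cylinder Γ t + G.chain))
    (i : Fin N) (x y : ℤ) :
    pigmentWeb Γ t c i (x - 1, y, 0) + pigmentWeb Γ t c i (x, y - 1, 1) =
      pigmentWeb Γ t c i (x, y, 0) + pigmentWeb Γ t c i (x, y, 1) := by
  classical
  -- The sign change on edges in the second direction is the one built into `cylinder`; it turns the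
  -- incidence signs around the vertical edge into inflow minus outflow.
  have ho : ∀ e : PEdge, orientedChain (F.chain + cylinder Γ t + G.chain) (c i) (wall e t) =
      if e.2.2 = 0 then pigmentWeb Γ t c i e else -pigmentWeb Γ t c i e := by
    intro e
    simp only [orientedChain, closure_wall, pigmentWeb]
    split_ifs <;> simp
  unfold colorings at hc
  have h := (Finset.mem_filter.1 hc).2.2 i (![x, y, t], 2)
  have hx : (![x, y, t] - unitVec 0 : Pt) = ![x - 1, y, t] := by
    ext j; fin_cases j <;> simp [unitVec]
  have hy : (![x, y, t] - unitVec 1 : Pt) = ![x, y - 1, t] := by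
    ext j; fin_cases j <;> simp [unitVec]
  have a1 : (2 + 1 : Fin 3) = 0 := rfl
  have a2 : (2 + 2 : Fin 3) = 1 := rfl
  simp only [boundary, Fin.sum_univ_four, incidence, around, a1, a2, hx, hy] at h
  have h1 := ho (x, y, 0)
  have h2 := ho (x, y, 1)
  have h3 := ho (x - 1, y, 0)
  have h4 := ho (x, y - 1, 1)
  simp [wall] at h h1 h2 h3 h4
  rw [h1, h2, h3, h4] at h
  linarith

/-- The edges `e`, `e'` of `Γ` are labeled `1`, and no pigment occurs on both of them, in any coloring
of a closed foam that contains a collar of `Γ` at height `t`. -/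
structure DistinctPigments (N : ℕ) (Γ : Web) (t : ℤ) (e e' : PEdge) : Prop where
  left : (Γ e).natAbs = 1
  right : (Γ e').natAbs = 1
  ne : ∀ (F : LowerFoam t) (G : UpperFoam t),
    ∀ c ∈ colorings N (F.chain + cylinder Γ t + G.chain), ∀ i, wall e t ∈ c i → wall e' t ∉ c i

-- The added dots do not change the underlying foam, so the colorings stay the same and `a`, `b`
-- enter only through a monomial in the pigment variables. The functions `i`, `j` read off these
-- pigments from a coloring.
open scoped Classical in
lemma closureEval_addDots {N : ℕ} {Γ : Web} {t : ℤ} {e e' : PEdge} (F : LowerFoam t)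
    (G : UpperFoam t) (i j : (Fin N → Finset Plaq) → Fin N)
    (hi : ∀ c ∈ colorings N (F.chain + cylinder Γ t + G.chain), ∀ k, wall e t ∈ c k ↔ k = i c)
    (hj : ∀ c ∈ colorings N (F.chain + cylinder Γ t + G.chain), ∀ k, wall e' t ∈ c k ↔ k = j c)
    (a b : ℕ) :
    closureEval N Γ (F.addDots e e' a b) G =
      if IsClosedFoam (F.chain + cylinder Γ t + G.chain) then
        ∑ c ∈ colorings N (F.chain + cylinder Γ t + G.chain),
          var (i c) ^ a * var (j c) ^ b *
            coloredEval (F.chain + cylinder Γ t + G.chain) (F.dots + G.dots) c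
      else 0 := by
  simp only [closureEval, eval, LowerFoam.addDots, LowerFoam.iterate_addDot_chain,
    LowerFoam.iterate_addDot_dots]
  refine if_congr Iff.rfl (Finset.sum_congr rfl fun c hc => ?_) rfl
  rw [Multiset.add_assoc, Multiset.add_assoc, coloredEval_replicate_add (hi c hc),
    coloredEval_replicate_add (hj c hc), mul_assoc]

/-! ### From identities between pigment variables to identities between dot operators. -/

lemma intDotMap_pow_mul_pow_mkQ {N : ℕ} {Γ : Web} {t : ℤ} (e e' : PEdge) (a b : ℕ)
    (F : LowerFoam t) :
    (intDotMap N Γ t e 1 ^ a * intDotMap N Γ t e' 1 ^ b)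
        ((relations N Γ t).mkQ (Finsupp.single F 1)) =
      (relations N Γ t).mkQ (Finsupp.single (F.addDots e e' a b) 1) := by
  have h1 : ∀ (e : PEdge) (a : ℕ) (F : LowerFoam t), (intDotMap N Γ t e 1 ^ a)
      ((relations N Γ t).mkQ (Finsupp.single F 1)) =
      (relations N Γ t).mkQ (Finsupp.single ((LowerFoam.addDot e 1)^[a] F) 1) := by
    intro e a F
    induction a with
    | zero => rfl
    | succ a ih =>
      rw [pow_succ', Module.End.mul_apply, ih, Function.iterate_succ_apply']
      simp [intDotMap, Finsupp.mapDomain_single]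
  rw [Module.End.mul_apply, h1, h1, LowerFoam.addDots]

/-- A linear relation between dots on two edges holds in the state space if it holds for the
variables of their pigments. -/
lemma sum_smul_intDotMap_eq_zero {N : ℕ} (hN : 1 ≤ N) {Γ : Web} {t : ℤ} {e e' : PEdge}
    (he : (Γ e).natAbs = 1) (he' : (Γ e').natAbs = 1) {ι : Type*} (S : Finset ι) (s : ι → Sym N)
    (a b : ι → ℕ)
    (h : ∀ (F : LowerFoam t) (G : UpperFoam t),
      ∀ c ∈ colorings N (F.chain + cylinder Γ t + G.chain), ∀ i j : Fin N,
        wall e t ∈ c i → wall e' t ∈ c j →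
        ∑ m ∈ S, s m • (var i ^ a m * var j ^ b m : RatFun N) = 0) :
    ∑ m ∈ S, s m • (intDotMap N Γ t e 1 ^ a m * intDotMap N Γ t e' 1 ^ b m) = 0 := by
  classical
  refine Submodule.linearMap_qext _ (Finsupp.lhom_ext' fun F => LinearMap.ext_ring ?_)
  simp only [LinearMap.comp_apply, Finsupp.lsingle_apply, LinearMap.sum_apply,
    LinearMap.smul_apply, LinearMap.zero_apply, intDotMap_pow_mul_pow_mkQ]
  rw [← map_zero (relations N Γ t).mkQ]
  simp only [← map_smul, ← map_sum]
  rw [Submodule.mkQ_apply, Submodule.mkQ_apply, Submodule.Quotient.eq, sub_zero]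
  -- The relation holds equivariantly: the combination lies in the radical, and no symmetric
  -- polynomial has to be killed yet.
  refine Submodule.mem_sup_left ?_
  simp only [radical, Submodule.mem_iInf, LinearMap.mem_ker]
  intro G
  -- A default pigment makes the choice functions below total; its value outside the colorings plays
  -- no role.
  have : Nonempty (Fin N) := ⟨⟨0, hN⟩⟩
  have hi : ∀ c, ∃ i : Fin N, c ∈ colorings N (F.chain + cylinder Γ t + G.chain) →
      ∀ k, wall e t ∈ c k ↔ k = i := fun c => by
    by_cases hc : c ∈ colorings N (F.chain + cylinder Γ t + G.chain)
    · obtain ⟨i, hi⟩ := exists_pigment hc he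
      exact ⟨i, fun _ => hi⟩
    · exact ⟨Classical.arbitrary _, fun h => absurd h hc⟩
  have hj : ∀ c, ∃ i : Fin N, c ∈ colorings N (F.chain + cylinder Γ t + G.chain) →
      ∀ k, wall e' t ∈ c k ↔ k = i := fun c => by
    by_cases hc : c ∈ colorings N (F.chain + cylinder Γ t + G.chain)
    · obtain ⟨i, hi⟩ := exists_pigment hc he'
      exact ⟨i, fun _ => hi⟩
    · exact ⟨Classical.arbitrary _, fun h => absurd h hc⟩
  choose i hi using hi
  choose j hj using hj
  simp only [map_sum, map_smul, pairing, Finsupp.linearCombination_single, one_smul,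
    closureEval_addDots F G i j hi hj]
  split_ifs
  · simp only [Finset.smul_sum]
    -- For a fixed coloring, the colored evaluation of the undecorated closure factors out and the
    -- remaining sum is the hypothesis `h`.
    rw [Finset.sum_comm]
    refine Finset.sum_eq_zero fun c hc => ?_
    have := h F G c hc (i c) (j c) ((hi c hc _).2 rfl) ((hj c hc _).2 rfl)
    simp only [smul_ratFun, ← mul_assoc] at this ⊢
    rw [← Finset.sum_mul, this, zero_mul]
  · simp

/-! ### Relations after killing the symmetric polynomials without constant term. -/

/-- Symmetric polynomials without constant term act by zero on the state space. -/
lemma smul_intStateSpace_eq_zero {N : ℕ} {Γ : Web} {t : ℤ} {s : Sym N} (hs : s ∈ augIdeal N)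
    (x : IntStateSpace N Γ t) : s • x = 0 := by
  obtain ⟨y, rfl⟩ := Submodule.Quotient.mk_surjective _ x
  rw [← Submodule.Quotient.mk_smul, Submodule.Quotient.mk_eq_zero]
  exact Submodule.mem_sup_right (Submodule.smul_mem_smul hs trivial)

/-- Only the leading coefficient of the characteristic polynomial, the elementary symmetric
polynomial of degree `0`, survives in the state space. -/
lemma sum_symEsymm_smul_end {N : ℕ} {Γ : Web} {t : ℤ}
    (φ : ℕ → Module.End (Sym N) (IntStateSpace N Γ t)) :
    ∑ k ∈ Finset.range (N + 1), ((-1) ^ k * symEsymm N k) • φ k = φ 0 := by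
  rw [Finset.sum_eq_single_of_mem 0 (by simp)]
  · simp [symEsymm_zero]
  · intro k _ hk
    refine LinearMap.ext fun x => ?_
    exact smul_intStateSpace_eq_zero (Ideal.mul_mem_left _ _ (symEsymm_mem_augIdeal N hk)) _

/-- This is the root equation of the single pigment on `e`; the two-edge transfer is applied with
both edges equal and no dots on the second. -/
lemma intDotMap_pow_eq_zero {N : ℕ} (hN : 1 ≤ N) {Γ : Web} {t : ℤ} {e : PEdge} (he : (Γ e).natAbs = 1) :
    intDotMap N Γ t e 1 ^ N = 0 := by
  have h := sum_smul_intDotMap_eq_zero (t := t) hN he he (Finset.range (N + 1))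
    (fun k => (-1) ^ k * symEsymm N k) (fun k => N - k) (fun _ => 0)
    (fun _ _ _ _ i _ _ _ => by simpa using sum_symEsymm_smul_var_pow i)
  rw [sum_symEsymm_smul_end
    (fun k => intDotMap N Γ t e 1 ^ (N - k) * intDotMap N Γ t e 1 ^ 0)] at h
  simpa using h

/-- The vanishing divided difference, transferred to operators; it requires the two pigments to
differ in every coloring. -/
lemma sum_intDotMap_pow_mul_pow_eq_zero {N : ℕ} (hN : 1 ≤ N) {Γ : Web} {t : ℤ} {e e' : PEdge}
    (h : DistinctPigments N Γ t e e') :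
    ∑ l ∈ Finset.range N, intDotMap N Γ t e 1 ^ l * intDotMap N Γ t e' 1 ^ (N - 1 - l) = 0 := by
  have h := sum_smul_intDotMap_eq_zero (t := t) hN h.left h.right
    ((Finset.range (N + 1)).sigma fun k => Finset.range (N - k))
    (fun m => (-1) ^ m.1 * symEsymm N m.1) (fun m => m.2) (fun m => N - m.1 - 1 - m.2)
    (fun F G c hc i j hi hj => by
      have hij : i ≠ j := by rintro rfl; exact h.ne F G c hc i hi hj
      rw [Finset.sum_sigma]
      simpa only [Finset.smul_sum] using sum_symEsymm_smul_geom_sum hij)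
  rw [Finset.sum_sigma] at h
  simp only [← Finset.smul_sum] at h
  rw [sum_symEsymm_smul_end (fun k => ∑ l ∈ Finset.range (N - k),
    intDotMap N Γ t e 1 ^ l * intDotMap N Γ t e' 1 ^ (N - k - 1 - l))] at h
  exact h

/-- If `X ^ N = 0` and the complete homogeneous polynomial of degree `N - 1` in
`X` and `Y` vanishes, then `X ^ (N - 1) * Y ^ (N - 1) = 0`. -/
lemma pow_mul_pow_eq_zero_of_geom_sum {A : Type*} [Ring A] {X Y : A} {N : ℕ} (hN : 1 ≤ N)
    (hX : X ^ N = 0)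
    (h : ∑ l ∈ Finset.range N, X ^ l * Y ^ (N - 1 - l) = 0) :
    X ^ (N - 1) * Y ^ (N - 1) = 0 := by
  have h2 := congrArg (X ^ (N - 1) * ·) h
  simp only [Finset.mul_sum, mul_zero] at h2
  -- Every term with `l ≥ 1` contains `X ^ (N - 1 + l)`, a multiple of `X ^ N`. As the
  -- multiplication is from the left, `X` and `Y` need not commute.
  rw [Finset.sum_eq_single_of_mem 0 (Finset.mem_range.2 hN)] at h2
  · simpa using h2
  · intro l _ hl
    rw [← mul_assoc, ← pow_add, pow_eq_zero_of_le (by omega) hX, zero_mul]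

/-! ### Extension of scalars to `R`. -/

lemma dotMap_pow_tmul {N : ℕ} {R : Type*} [CommRing R] {Γ : Web} {t : ℤ} (e : PEdge) (a : ℕ)
    (ρ : R) (m : IntStateSpace N Γ t) :
    (dotMap N R Γ t e 1 ^ a) (ρ ⊗ₜ[ℤ] m : R ⊗[ℤ] IntStateSpace N Γ t) =
      (ρ ⊗ₜ[ℤ] (intDotMap N Γ t e 1 ^ a) m : R ⊗[ℤ] IntStateSpace N Γ t) := by
  induction a with
  | zero => rfl
  | succ a ih => rw [pow_succ', pow_succ']; exact congrArg (dotMap N R Γ t e 1) ih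

lemma DistinctPigments.dotMap_pow_dotMap_pow {N : ℕ} (hN : 1 ≤ N) {R : Type*} [CommRing R]
    {Γ : Web} {t : ℤ} {e e' : PEdge} (h : DistinctPigments N Γ t e e') (x : StateSpace N R Γ t) :
    (dotMap N R Γ t e 1 ^ (N - 1)) ((dotMap N R Γ t e' 1 ^ (N - 1)) x) = 0 := by
  have hz := pow_mul_pow_eq_zero_of_geom_sum hN (intDotMap_pow_eq_zero hN h.left)
    (sum_intDotMap_pow_mul_pow_eq_zero hN h)
  refine TensorProduct.induction_on (motive := fun x : R ⊗[ℤ] IntStateSpace N Γ t =>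
    (dotMap N R Γ t e 1 ^ (N - 1)) ((dotMap N R Γ t e' 1 ^ (N - 1)) x) = 0) x ?_ ?_ ?_
  · exact (congrArg _ (map_zero _)).trans (map_zero _)
  · intro ρ m
    rw [dotMap_pow_tmul, dotMap_pow_tmul, ← Module.End.mul_apply, hz]
    exact TensorProduct.tmul_zero _ _
  · intro y z hy hz
    refine (congrArg _ (map_add _ _ _)).trans ((map_add _ _ _).trans ?_)
    rw [hy, hz]; exact add_zero _

/-! ### The legs of the edge labeled `2` -/

namespace SingularDiagram

variable {n : ℕ} (D : SingularDiagram n)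

/-- Away from the other sites, `D_v` only sees the edge labeled `2`. -/
lemma resolution_apply_of_near (v : Fin n → Bool) (e : PEdge)
    (he : ∀ c, e ∉ square (D.site (some c))) :
    D.resolution v e = D.strands e - squareBoundary (D.site none) e := by
  simp only [resolution, Finsupp.sub_apply, Finsupp.finsetSum_apply]
  rw [Finset.sum_eq_zero, sub_zero]
  intro c _
  have h := he c
  simp only [square, Finset.mem_insert, Finset.mem_singleton, not_or] at h
  obtain ⟨h1, h2, h3, h4⟩ := h
  split_ifs
  · simp [squareBoundary, Finsupp.single_eq_of_ne h1, Finsupp.single_eq_of_ne h2,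
      Finsupp.single_eq_of_ne h3, Finsupp.single_eq_of_ne h4]
  · rfl

/-- The values of `D_v` on the edges at the four corners of the site of the edge labeled `2`. -/
lemma resolution_site (v : Fin n → Bool) {x y : ℤ} (hs : D.site none = (x, y)) :
    (D.resolution v (x, y - 1, 1) = 1 ∧ D.resolution v (x + 1, y - 1, 1) = 1 ∧
      D.resolution v (x, y + 1, 1) = 1 ∧ D.resolution v (x + 1, y + 1, 1) = 1) ∧
    (D.resolution v (x, y, 0) = -1 ∧ D.resolution v (x, y + 1, 0) = 1 ∧
      D.resolution v (x, y, 1) = 2 ∧ D.resolution v (x + 1, y, 1) = 0) ∧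
    (D.resolution v (x - 1, y, 0) = 0 ∧ D.resolution v (x - 1, y + 1, 0) = 0 ∧
      D.resolution v (x + 1, y, 0) = 0 ∧ D.resolution v (x + 1, y + 1, 0) = 0) := by
  have hup : ∀ i j : ℤ, i = 0 ∨ i = 1 → j = -1 ∨ j = 0 ∨ j = 1 →
      D.strands (x + i, y + j, 1) = 1 := by
    intro i j hi hj
    have := D.upward none i (by rw [Finset.mem_Icc]; omega) j (by rw [Finset.mem_Icc]; omega)
    rwa [hs] at this
  have u1 : D.strands (x, y - 1, 1) = 1 := by simpa [← sub_eq_add_neg] using hup 0 (-1) (by simp) (by simp)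
  have u2 : D.strands (x, y, 1) = 1 := by simpa using hup 0 0 (by simp) (by simp)
  have u3 : D.strands (x, y + 1, 1) = 1 := by simpa using hup 0 1 (by simp) (by simp)
  have u4 : D.strands (x + 1, y - 1, 1) = 1 := hup 1 (-1) (by simp) (by simp)
  have u5 : D.strands (x + 1, y, 1) = 1 := by simpa using hup 1 0 (by simp) (by simp)
  have u6 : D.strands (x + 1, y + 1, 1) = 1 := hup 1 1 (by simp) (by simp)
  have v1 := D.valence x y
  have v2 := D.valence x (y + 1)
  have v3 := D.valence (x + 1) y
  have v4 := D.valence (x + 1) (y + 1)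
  simp only [add_sub_cancel_right, u1, u2, u3, u4, u5, u6, abs_one] at v1 v2 v3 v4
  -- At each corner of the site the two vertical strand edges exhaust the valence, so `strands`
  -- vanishes on all horizontal edges there.
  have n : ∀ a b : ℤ, |a| + 1 + |b| + 1 ≤ 2 → a = 0 ∧ b = 0 := by
    intro a b h
    constructor <;> rw [← abs_nonpos_iff] <;> linarith [abs_nonneg a, abs_nonneg b]
  obtain ⟨z1, z2⟩ := n _ _ v1
  obtain ⟨z3, z4⟩ := n _ _ v2
  obtain ⟨-, z5⟩ := n _ _ v3
  obtain ⟨-, z6⟩ := n _ _ v4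
  -- The two implications leave out horizontal edges at height `y - 1` and vertical edges at
  -- abscissa `x - 1`: these can be the top or right side of a site at distance two.
  have hd : ∀ e : PEdge, (x - 1 ≤ e.1 ∧ e.1 ≤ x + 1 ∧ y - 1 ≤ e.2.1 ∧ e.2.1 ≤ y + 1 ∧
      (e.2.2 = 0 → y ≤ e.2.1) ∧ (e.2.2 = 1 → x ≤ e.1)) →
      ∀ c, e ∉ square (D.site (some c)) := by
    rintro ⟨a, b, d⟩ he c hm
    have := D.disjoint (some c) none (by simp)
    rw [hs, le_abs, le_abs] at this
    simp only [square, Finset.mem_insert, Finset.mem_singleton, Prod.mk.injEq] at hm he this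
    rcases hm with ⟨h1, h2, rfl⟩ | ⟨h1, h2, rfl⟩ | ⟨h1, h2, rfl⟩ | ⟨h1, h2, rfl⟩ <;>
      simp at he <;> omega
  have hr := fun e he => D.resolution_apply_of_near v e (hd e he)
  rw [hs] at hr
  refine ⟨⟨?_, ?_, ?_, ?_⟩, ⟨?_, ?_, ?_, ?_⟩, ⟨?_, ?_, ?_, ?_⟩⟩ <;>
    rw [hr _ (by simp <;> omega)] <;>
    simp [squareBoundary,  u1, u2, u3, u4, u5, u6, z1, z2, z3, z4, z5, z6]

/-- The two strands that enter the edge labeled `2`, or leave it, carry distinct pigments. -/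
lemma distinctPigments_leg (N : ℕ) (v : Fin n → Bool) (top right : Bool) :
    DistinctPigments N (D.resolution v) (height v) (D.leg top right).edge
      (D.leg top (!right)).edge := by
  classical
  obtain ⟨x, y, hs⟩ : ∃ x y, D.site none = (x, y) := ⟨_, _, rfl⟩
  obtain ⟨⟨l1, l2, l3, l4⟩, ⟨m1, m2, m3, m4⟩, ⟨o1, o2, o3, o4⟩⟩ := D.resolution_site v hs
  have key : ∀ (F : LowerFoam (height v)) (G : UpperFoam (height v)),
      ∀ c ∈ colorings N (F.chain + cylinder (D.resolution v) (height v) + G.chain), ∀ i,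
      ¬ (wall (x, y - 1, 1) (height v) ∈ c i ∧ wall (x + 1, y - 1, 1) (height v) ∈ c i) ∧
      ¬ (wall (x, y + 1, 1) (height v) ∈ c i ∧ wall (x + 1, y + 1, 1) (height v) ∈ c i) := by
    intro F G c hc i
    -- The left side of the square is the edge labeled `2` and its right side is absent; the
    -- right-hand strand reaches it leftwards along the bottom and departs rightwards along the top.
    -- A pigment on both lower legs would thus have flow `2` through the left side, by `c1` and
    -- `c2`, but a pigment's flow is at most `1`. The corners `c3` and `c4` treat the upper legs in
    -- the same way.
    have c1 := pigmentWeb_conservation hc i x y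
    have c2 := pigmentWeb_conservation hc i (x + 1) y
    have c3 := pigmentWeb_conservation hc i x (y + 1)
    have c4 := pigmentWeb_conservation hc i (x + 1) (y + 1)
    simp only [add_sub_cancel_right, pigmentWeb, l1, l2, l3, l4, m1, m2, m3, m4, o1, o2, o3, o4,
      Int.sign_zero, Int.sign_one, Int.sign_neg, ite_self, zero_add, add_zero,
      show Int.sign 2 = 1 from rfl] at c1 c2 c3 c4
    constructor <;> rintro ⟨h1, h2⟩ <;> simp only [h1, h2, if_true] at c1 c2 c3 c4 <;>
      split_ifs at c1 c2 c3 c4 <;> omega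
  refine ⟨?_, ?_, fun F G c hc i h1 h2 => ?_⟩
  · cases top <;> cases right <;> simp [leg, hs, ← sub_eq_add_neg, l1, l2, l3, l4]
  · cases top <;> cases right <;> simp [leg, hs, ← sub_eq_add_neg, l1, l2, l3, l4]
  · have := key F G c hc i
    cases top <;> cases right <;> simp [leg, hs, ← sub_eq_add_neg] at h1 h2 <;> tauto

/-! ### From state spaces to reduced homology. -/

variable {D}

lemma Basepoint.op_pow_apply (q : D.Basepoint) {N : ℕ} {R : Type*} [CommRing R] (a : ℕ)
    (x : D.Complex N R) (v : Fin n → Bool) :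
    (q.op N R ^ a) x v = (dotMap N R (D.resolution v) (height v) q.edge 1 ^ a) (x v) := by
  induction a with
  | zero => rfl
  | succ a ih => rw [pow_succ', Module.End.mul_apply, pow_succ', Module.End.mul_apply, ← ih]; rfl

lemma leg_op_pow_leg_op_pow {N : ℕ} (hN : 1 ≤ N) {R : Type*} [CommRing R] (top right : Bool)
    (x : D.Complex N R) :
    ((D.leg top (!right)).op N R ^ (N - 1)) (((D.leg top right).op N R ^ (N - 1)) x) = 0 := by
  funext v
  rw [Basepoint.op_pow_apply, Basepoint.op_pow_apply]
  have h := D.distinctPigments_leg N v top (!right)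
  rw [Bool.not_not] at h
  exact h.dotMap_pow_dotMap_pow hN (x v)

/-- Powers of the induced operator are computed on representatives; the existential supplies the
cycle condition needed to form the class on the right. -/
lemma reducedOp_pow_mk {N : ℕ} {R : Type*} [CommRing R] {q : D.Basepoint} (r : D.Basepoint)
    (a : ℕ) {x : D.Complex N R} (hx : x ∈ D.reducedCycles N R q) :
    ∃ h : (r.op N R ^ a) x ∈ D.reducedCycles N R q,
      (reducedOp N R q r ^ a) (Submodule.Quotient.mk ⟨x, hx⟩) =
        Submodule.Quotient.mk ⟨(r.op N R ^ a) x, h⟩ := by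
  induction a with
  | zero => exact ⟨hx, rfl⟩
  | succ a ih =>
    obtain ⟨h, ih⟩ := ih
    simp only [pow_succ', Module.End.mul_apply, ih]
    exact ⟨op_mem_reducedCycles r h, rfl⟩

end SingularDiagram

end SlN

theorem lemma3p1 (N : ℕ) (hN : 2 ≤ N) (R : Type*) [CommRing R] {n : ℕ}
    (D : SlN.SingularDiagram n) (top right : Bool) :
    SlN.SingularDiagram.reducedOp N R (D.leg top right) (D.leg top (!right)) ^ (N - 1) = 0 := by
  refine Submodule.linearMap_qext _ (LinearMap.ext fun x => ?_)
  obtain ⟨x, hx⟩ := x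
  -- A reduced cycle has the form `X_q ^ (N - 1) y`. Applying `X_r ^ (N - 1)` makes this
  -- representative zero as a chain, so the boundary to be exhibited is zero.
  obtain ⟨y, rfl⟩ := hx.1
  obtain ⟨h', h⟩ := SlN.SingularDiagram.reducedOp_pow_mk (D.leg top !right) (N - 1) hx
  refine h.trans ((Submodule.Quotient.mk_eq_zero _).2 ?_)
  change _ ∈ SlN.SingularDiagram.reducedBoundaries D N R _
  have := SlN.SingularDiagram.leg_op_pow_leg_op_pow (by omega) top right y
  exact (congrArg (· ∈ D.reducedBoundaries N R (D.leg top right)) this).mpr (Submodule.zero_mem _)
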